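/- Let $\rho,\mu:[0,\infty)\to(0,\infty)$ be Lipschitz continuous with finite positive limits $\rho_\infty=\lim_{y\to\infty}\rho(y)$ and $\mu_\infty=\lim_{y\to\infty}\mu(y)$, and let $\rho-\rho_\infty$ and $\mu-\mu_\infty$ be integrable on $[0,\infty)$. Assume positive monotonicity at infinity: there is $\bar y\ge 0$ such that $\arctan\frac{\mu(y)}{\rho(y)}<\arctan\frac{\mu_\infty}{\rho_\infty}$ for all $y>\bar y$. Put $$\hat\gamma_\infty(y)=\mu_\infty(\rho(y)-\rho_\infty)-\rho_\infty(\mu(y)-\mu_\infty).$$ For parameters $(K,\Omega)$ consider the boundary value problem on $[0,\infty)$ $$(\mu u')'+(\Omega\rho-K\mu)u=0,\qquad u'(0)=0,\qquad \lim_{y\to+\infty}u(y)=0, \tag{1}$$ where "solution" means a solution that is not identically zero. For a solution with $u(0)>0$ put $w=\mu u'$, $Z=(w,u)$, and let the Prüfer angle $\operatorname{Arg}Z(y)$ be the continuous function with $\operatorname{Arg}Z(0)=\pi/2$ and $w=|Z|\cos\operatorname{Arg}Z$, $u=|Z|\sin\operatorname{Arg}Z$, where $|Z|=(u^2+w^2)^{1/2}$.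 Then $\mu/\rho$ attains its minimum on $[0,\infty)$; let $\check y$ be a point of minimum, $\check\mu=\mu(\check y)$ and $\check\rho=\rho(\check y)$. For every $\bar K>0$ for which the limit-case equation $$(\mu u')'+\beta\,\hat\gamma_\infty u=0,\qquad \beta=\bar K/\rho_\infty,$$ is oscillatory (that is, the set of zeros of each of its nontrivial solutions on $[0,\infty)$ is unbounded), there is a strictly increasing sequence $\Omega_m\in\left(\frac{\check\mu}{\check\rho}\bar K,\ \frac{\mu_\infty}{\rho_\infty}\bar K\right)$, $m=1,2,\dots$, such that: (i) for each $m$, problem (1) with $A_m=(\bar K,\Omega_m)$ has a solution; (ii) $\Omega_m\to\frac{\mu_\infty}{\rho_\infty}\bar K$ as $m\to\infty$, so that this is the only accumulation point of the sequence; (iii) for each $m$, problem (1) with $A_m$ has a solution with $u(0)>0$ whose vector $Z(y;A_m)$ satisfies $\operatorname{Arg}Z(y;A_m)\in[(m-\frac12)\pi,\,m\pi]$ for all sufficiently large $y$, and it is the unique such solution: if for some real $\Omega'$ problem (1) with $(\bar K,\Omega')$ has a solution with $u(0)>0$ whose Prüfer angle lies in $[(m-\frac12)\pi,\,m\pi]$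 for all sufficiently large $y$, then $\Omega'=\Omega_m$ and that solution is a positive constant multiple of $Z(\cdot;A_m)$. In particular, if the limit-case equation is oscillatory for every $\beta>0$, such a sequence exists for every $\bar K>0$. -/

import Mathlib

open Set Filter Topology MeasureTheory

/-- `u` solves `(μ u')' + γ u = 0` on the closed half-line `[0, ∞)`, with `w = μ u'`
(one-sided derivatives at `0`). -/
structure IsSLSolution (μ γ u w : ℝ → ℝ) : Prop where
  hasDeriv_u : ∀ y ∈ Ici (0 : ℝ), HasDerivWithinAt u (w y / μ y) (Ici 0) y
  hasDeriv_w : ∀ y ∈ Ici (0 : ℝ), HasDerivWithinAt w (-(γ y * u y)) (Ici 0) y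

/-- The function does not vanish identically on `[0, ∞)`. -/
def NontrivialOnHalfLine (u : ℝ → ℝ) : Prop := ∃ y ∈ Ici (0 : ℝ), u y ≠ 0

/-- The equation `(μ u')' + γ u = 0` is oscillatory on `[0, ∞)`: the set of zeros of each of its
nontrivial solutions has no upper bound. -/
def IsOscillatory (μ γ : ℝ → ℝ) : Prop :=
  ∀ u w : ℝ → ℝ, IsSLSolution μ γ u w → NontrivialOnHalfLine u →
    ¬ BddAbove {y : ℝ | y ∈ Ici (0 : ℝ) ∧ u y = 0}

/-- The density `ρ` and the stiffness `μ` of the medium are positive and Lipschitz continuous on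
`[0, ∞)`, have positive limits at infinity, and differ from these limits by integrable
functions. -/
structure IsMedium (ρ μ : ℝ → ℝ) (ρinf μinf : ℝ) : Prop where
  rho_pos : ∀ y ∈ Ici (0 : ℝ), 0 < ρ y
  mu_pos : ∀ y ∈ Ici (0 : ℝ), 0 < μ y
  rho_lipschitz : ∃ L, LipschitzOnWith L ρ (Ici 0)
  mu_lipschitz : ∃ L, LipschitzOnWith L μ (Ici 0)
  rhoInf_pos : 0 < ρinf
  muInf_pos : 0 < μinf
  rho_tendsto : Tendsto ρ atTop (𝓝 ρinf)
  mu_tendsto : Tendsto μ atTop (𝓝 μinf)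
  rho_integrable : IntegrableOn (fun y => ρ y - ρinf) (Ici 0)
  mu_integrable : IntegrableOn (fun y => μ y - μinf) (Ici 0)

/-- The polar angle of the vector `(r, m)` with positive coordinates. -/
noncomputable def mediumArg (r m : ℝ) : ℝ := Real.arctan (m / r)

/-- Positive monotonicity at infinity: `Arg (ρ y, μ y) < Arg (ρinf, μinf)` on some interval
`(ybar, ∞)`. -/
def PositiveMonotoneAtInfinity (ρ μ : ℝ → ℝ) (ρinf μinf : ℝ) : Prop :=
  ∃ ybar ∈ Ici (0 : ℝ), ∀ y ∈ Ioi ybar, mediumArg (ρ y) (μ y) < mediumArg ρinf μinf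

/-- The coefficient `Ω ρ - K μ` of the parametric equation. -/
def gammaCoeff (ρ μ : ℝ → ℝ) (K Ω : ℝ) (y : ℝ) : ℝ := Ω * ρ y - K * μ y

/-- The coefficient `μinf (ρ - ρinf) - ρinf (μ - μinf)` of the limit-case equation. -/
def gammaHatInf (ρ μ : ℝ → ℝ) (ρinf μinf : ℝ) (y : ℝ) : ℝ :=
  μinf * (ρ y - ρinf) - ρinf * (μ y - μinf)

/-- `(u, w)`, `w = μ u'`, is a nontrivial solution of the boundary value problem
`(μ u')' + (Ω ρ - K μ) u = 0`, `u'(0) = 0`, `u(y) → 0` as `y → ∞`. -/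
structure IsBVPSolution (ρ μ : ℝ → ℝ) (K Ω : ℝ) (u w : ℝ → ℝ) : Prop where
  solution : IsSLSolution μ (gammaCoeff ρ μ K Ω) u w
  nontrivial : NontrivialOnHalfLine u
  neumann : HasDerivWithinAt u 0 (Ici 0) 0
  decay : Tendsto u atTop (𝓝 0)

/-- `φ` is the continuous branch on `[0, ∞)`, starting from `φ 0 = π / 2`, of the argument of the
vector `Z = (w, u)`, that is, `w = r cos φ` and `u = r sin φ` with `r = (u ^ 2 + w ^ 2) ^ (1 / 2)`.
For a nontrivial `Z` with `w 0 = 0` it exists exactly when `0 < u 0`. -/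
structure IsPruferAngle (u w φ : ℝ → ℝ) : Prop where
  continuousOn : ContinuousOn φ (Ici 0)
  initial : φ 0 = Real.pi / 2
  cos_eq : ∀ y ∈ Ici (0 : ℝ), w y = Real.sqrt (u y ^ 2 + w y ^ 2) * Real.cos (φ y)
  sin_eq : ∀ y ∈ Ici (0 : ℝ), u y = Real.sqrt (u y ^ 2 + w y ^ 2) * Real.sin (φ y)

/-- The Prüfer angle of `(w, u)` lies in `[(m - 1/2) π, m π]` for all sufficiently large `y`. -/
def EndsInSector (m : ℕ) (u w : ℝ → ℝ) : Prop :=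
  ∃ φ : ℝ → ℝ, IsPruferAngle u w φ ∧
    ∀ᶠ y in atTop, φ y ∈ Icc (((m : ℝ) - 1 / 2) * Real.pi) ((m : ℝ) * Real.pi)

/-!
Everything is read off from the Prüfer angle `φ` of `(w, u)`, which solves the scalar equation
`φ' = cos² φ / μ + γ sin² φ`, `φ 0 = π / 2`, with `γ = Ω ρ - K μ`. Its right-hand side is bounded in
`φ`, so a global solution exists (`exists_pruferSolution`); integrating the logarithmic derivative
of the modulus recovers the solution `(w, u)`, and every solution of the boundary value problem with
`u 0 > 0` is a positive multiple of it with the same angle (`IsPruferSolution.eq_const_mul`).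

The angle crosses the multiples of `π` only upwards. For `Ω` below `Ω* = (μinf / ρinf) K` the
coefficient `γ` is negative near infinity, and there the angle crosses the odd multiples of `π / 2`
only downwards. At each point `y > 0` the angle is continuous and strictly increasing in `Ω`. At
`Ω = Ω*` the equation is the limit-case equation, so by oscillation the angle is unbounded, while
below `Ω*` it is bounded. Hence, within `(-∞, Ω*)`, the parameters whose angle exceeds `m π`
somewhere and those whose angle ends below `(m - 1/2) π` form disjoint nonempty open sets, and
connectedness provides a parameter in neither (`IsPruferFamily.exists_endsInSector`). Its angle is
trapped in `[(m - 1/2) π, m π]`, where `u w ≤ 0`, which forces `u` to decay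
(`tendsto_zero_of_mul_nonpos`).

Two parameters below `Ω*` cannot both end in the same sector, since the Wronskian of the two
solutions would be positive, nondecreasing and convergent to `0`
(`IsPruferSolution.not_same_sector`); from `Ω*` on, the angle leaves every sector. The order and the
limit of the sequence follow from the monotonicity in `Ω` and the boundedness of the angle below
`Ω*`. Finally, for `Ω ≤ K min (μ / ρ)` the coefficient `γ` is nonpositive and no nontrivial solution
with `u' 0 = 0` decays.

The coefficients are extended to the whole line by their values at `0`, so that one-sided
derivatives appear only when the given solutions are compared with the constructed ones.
-/

/-! ### The Prüfer equation -/

/-- The right-hand side `p cos² x + q sin² x` of the Prüfer equation, which governs the polar angle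
of `(w, u)` when `u' = p w` and `w' = -q u`. -/
noncomputable def pruferField (p q : ℝ → ℝ) (t x : ℝ) : ℝ :=
  p t * Real.cos x ^ 2 + q t * Real.sin x ^ 2

/-- `φ` solves the Prüfer equation on the whole line, with `φ 0 = π / 2`. -/
structure IsPruferSolution (p q φ : ℝ → ℝ) : Prop where
  initial : φ 0 = Real.pi / 2
  hasDeriv : ∀ t, HasDerivAt φ (pruferField p q t (φ t)) t

lemma IsPruferSolution.continuous {p q φ : ℝ → ℝ} (h : IsPruferSolution p q φ) : Continuous φ :=
  continuous_iff_continuousAt.2 fun t => (h.hasDeriv t).continuousAt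

lemma abs_pruferField_le {p q : ℝ → ℝ} {t C : ℝ} (hp : |p t| ≤ C) (hq : |q t| ≤ C) (x : ℝ) :
    |pruferField p q t x| ≤ C := by
  have h := Real.cos_sq_add_sin_sq x
  have h1 := abs_le.1 hp
  have h2 := abs_le.1 hq
  have h3 := sq_nonneg (Real.cos x)
  have h4 := sq_nonneg (Real.sin x)
  rw [abs_le]
  unfold pruferField
  constructor <;> nlinarith

/-- The increment of the Prüfer field is the increment of the angle times a factor that is
continuous also where the two angles agree. -/
lemma pruferField_sub (p q : ℝ → ℝ) (t x y : ℝ) :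
    pruferField p q t x - pruferField p q t y
      = (q t - p t) * Real.sinc (x - y) * Real.sin (x + y) * (x - y) := by
  have hs : Real.sinc (x - y) * (x - y) = Real.sin (x - y) := by
    rcases eq_or_ne (x - y) 0 with h | h
    · simp [h]
    · rw [Real.sinc_of_ne_zero h]; field_simp
  have : Real.sin (x - y) * Real.sin (x + y) = Real.sin x ^ 2 - Real.sin y ^ 2 := by
    rw [Real.sin_sub, Real.sin_add]
    have h1 := Real.sin_sq_add_cos_sq x
    have h2 := Real.sin_sq_add_cos_sq y
    linear_combination (Real.sin x ^ 2) * h2 - (Real.sin y ^ 2) * h1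
  have h1 := Real.sin_sq_add_cos_sq x
  have h2 := Real.sin_sq_add_cos_sq y
  unfold pruferField
  linear_combination p t * h1 - p t * h2 - (q t - p t) * this
    - (q t - p t) * Real.sin (x + y) * hs

lemma abs_pruferField_sub_le {p q : ℝ → ℝ} {t C : ℝ} (hp : |p t| ≤ C) (hq : |q t| ≤ C)
    (x y : ℝ) : |pruferField p q t x - pruferField p q t y| ≤ 2 * C * |x - y| := by
  rw [pruferField_sub, abs_mul, abs_mul, abs_mul]
  have h1 : |q t - p t| ≤ 2 * C := (abs_sub _ _).trans (by linarith)
  have h2 := Real.abs_sinc_le_one (x - y)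
  have h3 := Real.abs_sin_le_one (x + y)
  have hC : 0 ≤ C := (abs_nonneg _).trans hp
  have h4 : |q t - p t| * |Real.sinc (x - y)| ≤ 2 * C * 1 :=
    mul_le_mul h1 h2 (abs_nonneg _) (by linarith)
  have h5 : |q t - p t| * |Real.sinc (x - y)| * |Real.sin (x + y)| ≤ 2 * C * 1 * 1 :=
    mul_le_mul h4 h3 (abs_nonneg _) (by linarith)
  exact mul_le_mul_of_nonneg_right (by linarith) (abs_nonneg _)

lemma continuous_pruferField_left {p q : ℝ → ℝ} (hp : Continuous p) (hq : Continuous q) (x : ℝ) :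
    Continuous (fun t => pruferField p q t x) := by
  unfold pruferField
  fun_prop

lemma exists_abs_le_Icc {p q : ℝ → ℝ} (hp : Continuous p) (hq : Continuous q) (a b : ℝ) :
    ∃ C : NNReal, ∀ t ∈ Icc a b, |p t| ≤ C ∧ |q t| ≤ C := by
  obtain ⟨C₁, h₁⟩ := (isCompact_Icc (a := a) (b := b)).exists_bound_of_continuousOn hp.continuousOn
  obtain ⟨C₂, h₂⟩ := (isCompact_Icc (a := a) (b := b)).exists_bound_of_continuousOn hq.continuousOn
  refine ⟨Real.toNNReal (max C₁ C₂), fun t ht => ⟨?_, ?_⟩⟩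
  · exact (h₁ t ht).trans ((le_max_left _ _).trans (Real.le_coe_toNNReal _))
  · exact (h₂ t ht).trans ((le_max_right _ _).trans (Real.le_coe_toNNReal _))

/-- Since the Prüfer field is bounded in `x`, one application of the Picard-Lindelöf theorem yields
a solution on an interval of any prescribed length. -/
lemma exists_pruferSolution_Icc {p q : ℝ → ℝ} (hp : Continuous p) (hq : Continuous q) {T : ℝ}
    (hT : 0 ≤ T) :
    ∃ φ : ℝ → ℝ, φ 0 = Real.pi / 2 ∧
      ∀ t ∈ Ioo (-T) T, HasDerivAt φ (pruferField p q t (φ t)) t := by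
  obtain ⟨C, hC⟩ := exists_abs_le_Icc hp hq (-T) T
  have hPL : IsPicardLindelof (pruferField p q) (tmin := -T) (tmax := T)
      ⟨0, by constructor <;> linarith⟩ (Real.pi / 2) (C * T.toNNReal) 0 C (2 * C) := by
    refine ⟨fun t ht => ?_, fun x _ => (continuous_pruferField_left hp hq x).continuousOn,
      fun t ht x _ => abs_pruferField_le (hC t ht).1 (hC t ht).2 x, ?_⟩
    · refine LipschitzOnWith.of_dist_le_mul fun x _ y _ => ?_
      exact abs_pruferField_sub_le (hC t ht).1 (hC t ht).2 x y
    · simp [hT]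
  obtain ⟨φ, h0, hφ⟩ := hPL.exists_eq_forall_mem_Icc_hasDerivWithinAt₀
  exact ⟨φ, h0, fun t ht => (hφ t (Ioo_subset_Icc_self ht)).hasDerivAt (Icc_mem_nhds ht.1 ht.2)⟩

lemma pruferSolution_eqOn_Ioo {p q : ℝ → ℝ} (hp : Continuous p) (hq : Continuous q) {T : ℝ}
    (hT : 0 < T) {φ ψ : ℝ → ℝ}
    (hφ : ∀ t ∈ Ioo (-T) T, HasDerivAt φ (pruferField p q t (φ t)) t)
    (hψ : ∀ t ∈ Ioo (-T) T, HasDerivAt ψ (pruferField p q t (ψ t)) t) (h0 : φ 0 = ψ 0) :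
    EqOn φ ψ (Ioo (-T) T) := by
  obtain ⟨C, hC⟩ := exists_abs_le_Icc hp hq (-T) T
  refine ODE_solution_unique_of_mem_Ioo (K := 2 * C) (s := fun _ => univ) (t₀ := 0)
    (v := pruferField p q) (fun t ht => ?_) ⟨by linarith, hT⟩ (fun t ht => ⟨hφ t ht, trivial⟩)
    (fun t ht => ⟨hψ t ht, trivial⟩) h0
  refine LipschitzOnWith.of_dist_le_mul fun x _ y _ => ?_
  have := hC t (Ioo_subset_Icc_self ht)
  exact abs_pruferField_sub_le this.1 this.2 x y

theorem exists_pruferSolution {p q : ℝ → ℝ} (hp : Continuous p) (hq : Continuous q) :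
    ∃ φ : ℝ → ℝ, IsPruferSolution p q φ := by
  have h : ∀ n : ℕ, ∃ φ : ℝ → ℝ, φ 0 = Real.pi / 2 ∧
      ∀ t ∈ Ioo (-((n : ℝ) + 1)) (n + 1), HasDerivAt φ (pruferField p q t (φ t)) t :=
    fun n => exists_pruferSolution_Icc hp hq (by positivity)
  choose φ h0 hφ using h
  -- Near `t` all solutions of index at least `|t|` agree, by uniqueness.
  have key : ∀ (n : ℕ) (t : ℝ), |t| < n + 1 → φ ⌈|t|⌉₊ t = φ n t := by
    have mono : ∀ m n : ℕ, m ≤ n → ∀ t : ℝ, |t| < m + 1 → φ m t = φ n t := by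
      intro m n hmn t ht
      have hmn' : (m : ℝ) ≤ n := by exact_mod_cast hmn
      exact pruferSolution_eqOn_Ioo hp hq (by positivity) (hφ m)
        (fun s hs => hφ n s ⟨by linarith [hs.1], by linarith [hs.2]⟩)
        ((h0 m).trans (h0 n).symm) (abs_lt.1 ht)
    intro n t ht
    rcases le_total ⌈|t|⌉₊ n with h | h
    · exact mono _ _ h t ((Nat.le_ceil _).trans_lt (lt_add_one _))
    · exact (mono _ _ h t ht).symm
  refine ⟨fun t => φ ⌈|t|⌉₊ t, ?_, fun t => ?_⟩
  · simpa using h0 0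
  · have ht : |t| < (⌈|t|⌉₊ : ℝ) + 1 := (Nat.le_ceil _).trans_lt (lt_add_one _)
    refine (hφ ⌈|t|⌉₊ t (abs_lt.1 ht)).congr_of_eventuallyEq ?_
    filter_upwards [(continuous_abs.tendsto t).eventually (gt_mem_nhds ht)] with s hs
    exact key _ _ hs

/-! ### Comparison of Prüfer angles -/

lemma hasDerivAt_integral_of_continuous {f : ℝ → ℝ} (hf : Continuous f) (t : ℝ) :
    HasDerivAt (fun x => ∫ s in (0 : ℝ)..x, f s) (f t) t :=
  intervalIntegral.integral_hasDerivAt_right (hf.intervalIntegrable _ _)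
    (hf.stronglyMeasurableAtFilter _ _) hf.continuousAt

/-- A solution of `d' = a d + b`, `d 0 = 0`, with nonnegative `b` and `b 0 > 0`, is positive on
`(0, ∞)`. -/
lemma pos_of_hasDerivAt_linear {a b d : ℝ → ℝ} (ha : Continuous a)
    (hd : ∀ t, HasDerivAt d (a t * d t + b t) t) (hd0 : d 0 = 0) (hb : ∀ t ≥ 0, 0 ≤ b t)
    (hb0 : 0 < b 0) {t : ℝ} (ht : 0 < t) : 0 < d t := by
  set A : ℝ → ℝ := fun x => ∫ s in (0 : ℝ)..x, a s with hA
  set e : ℝ → ℝ := fun x => Real.exp (-A x) * d x with he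
  have hde : ∀ x, HasDerivAt e (Real.exp (-A x) * b x) x := fun x => by
    refine (((hasDerivAt_integral_of_continuous ha x).neg.exp).mul (hd x)).congr_deriv ?_
    simp only [Pi.neg_apply, hA]
    ring
  have hmono : MonotoneOn e (Ici 0) := by
    refine monotoneOn_of_hasDerivWithinAt_nonneg (convex_Ici 0)
      (fun x _ => (hde x).continuousAt.continuousWithinAt) (fun x _ => (hde x).hasDerivWithinAt) ?_
    intro x hx
    rw [interior_Ici] at hx
    exact mul_nonneg (Real.exp_pos _).le (hb x (le_of_lt hx))
  have he0 : e 0 = 0 := by simp [he, hd0]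
  have hpos : 0 < e t := by
    refine lt_of_le_of_ne (he0 ▸ hmono self_mem_Ici ht.le ht.le) fun h => ?_
    -- If `e t = 0` then `e` vanishes on `[0, t]`, but its derivative at `0` is positive.
    have hz : ∀ x ∈ Icc 0 t, e x = 0 := fun x hx =>
      le_antisymm (h ▸ hmono hx.1 ht.le hx.2) (he0 ▸ hmono self_mem_Ici hx.1 hx.1)
    have h1 : HasDerivWithinAt e 0 (Icc 0 t) 0 :=
      (hasDerivWithinAt_const (0 : ℝ) (Icc 0 t) (0 : ℝ)).congr hz (by simp [he0])
    have h2 := (uniqueDiffOn_Icc ht 0 (left_mem_Icc.2 ht.le)).eq_deriv _ h1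
      (hde 0).hasDerivWithinAt
    exact (mul_pos (Real.exp_pos _) hb0).ne h2
  exact pos_of_mul_pos_right hpos (Real.exp_pos _).le

/-- Sturm comparison: the Prüfer angle is strictly increasing in the coefficient `q`. -/
theorem IsPruferSolution.lt_of_le {p q₁ q₂ φ₁ φ₂ : ℝ → ℝ} (hp : Continuous p)
    (hq₂ : Continuous q₂) (h₁ : IsPruferSolution p q₁ φ₁)
    (h₂ : IsPruferSolution p q₂ φ₂) (hle : ∀ t ≥ 0, q₁ t ≤ q₂ t) (hlt : q₁ 0 < q₂ 0) {t : ℝ}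
    (ht : 0 < t) : φ₁ t < φ₂ t := by
  have hc₁ := h₁.continuous
  have hc₂ := h₂.continuous
  have hsinc := Real.continuous_sinc
  refine sub_pos.1 (pos_of_hasDerivAt_linear (d := fun t => φ₂ t - φ₁ t)
    (a := fun t => (q₂ t - p t) * Real.sinc (φ₂ t - φ₁ t) * Real.sin (φ₂ t + φ₁ t))
    (b := fun t => (q₂ t - q₁ t) * Real.sin (φ₁ t) ^ 2) (by fun_prop) (fun t => ?_) ?_
    (fun t ht => mul_nonneg (sub_nonneg.2 (hle t ht)) (sq_nonneg _)) ?_ ht)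
  · refine ((h₂.hasDeriv t).sub (h₁.hasDeriv t)).congr_deriv ?_
    rw [← pruferField_sub]
    unfold pruferField
    ring
  · simp [h₁.initial, h₂.initial]
  · simpa [h₁.initial] using hlt

/-- The Prüfer angle at a fixed point depends continuously on a parameter `Ω` that enters the
coefficient as `Ω ρ - κ`. -/
theorem continuous_pruferAngle_param {p ρ κ : ℝ → ℝ} (hp : Continuous p) (hρ : Continuous ρ)
    (hκ : Continuous κ) {Φ : ℝ → ℝ → ℝ}
    (hΦ : ∀ Ω, IsPruferSolution p (fun t => Ω * ρ t - κ t) (Φ Ω)) {T : ℝ} (hT : 0 ≤ T) :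
    Continuous fun Ω => Φ Ω T := by
  rw [continuous_iff_continuousAt]
  intro Ω₀
  obtain ⟨C, hC⟩ := exists_abs_le_Icc hp (q := fun t => Ω₀ * ρ t - κ t) (by fun_prop) 0 T
  obtain ⟨R, hR⟩ := exists_abs_le_Icc hρ hρ 0 T
  have hbound : ∀ Ω, dist (Φ Ω T) (Φ Ω₀ T) ≤ gronwallBound 0 (2 * C) (|Ω - Ω₀| * R) T := by
    intro Ω
    have := norm_le_gronwallBound_of_norm_deriv_right_le (f := fun t => Φ Ω t - Φ Ω₀ t)
      (f' := fun t => pruferField p (fun t => Ω * ρ t - κ t) t (Φ Ω t)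
        - pruferField p (fun t => Ω₀ * ρ t - κ t) t (Φ Ω₀ t)) (δ := 0) (K := 2 * C)
      (ε := |Ω - Ω₀| * R) (a := 0) (b := T)
      (((hΦ Ω).continuous.sub (hΦ Ω₀).continuous).continuousOn)
      (fun t _ => (((hΦ Ω).hasDeriv t).sub ((hΦ Ω₀).hasDeriv t)).hasDerivWithinAt)
      (by simp [(hΦ Ω).initial, (hΦ Ω₀).initial]) (fun t ht => ?_) T ⟨hT, le_rfl⟩
    · simpa [Real.dist_eq] using this
    · have ht' := Ico_subset_Icc_self ht
      have h1 := abs_pruferField_sub_le (q := fun t => Ω₀ * ρ t - κ t) (hC t ht').1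
        (hC t ht').2 (Φ Ω t) (Φ Ω₀ t)
      have h2 : |(Ω - Ω₀) * ρ t * Real.sin (Φ Ω t) ^ 2| ≤ |Ω - Ω₀| * R := by
        rw [abs_mul, abs_mul, abs_of_nonneg (sq_nonneg (Real.sin (Φ Ω t)))]
        have h3 := mul_le_mul_of_nonneg_left (hR t ht').1 (abs_nonneg (Ω - Ω₀))
        exact (mul_le_of_le_one_right (by positivity) (Real.sin_sq_le_one _)).trans h3
      rw [Real.norm_eq_abs, Real.norm_eq_abs]
      refine (le_of_eq_of_le (congrArg abs ?_) (abs_add_le _ _)).trans (add_le_add h1 h2)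
      unfold pruferField
      ring
  have hlim : Tendsto (fun Ω => gronwallBound 0 (2 * C) (|Ω - Ω₀| * R) T) (𝓝 Ω₀) (𝓝 0) := by
    have hc : Continuous fun Ω => gronwallBound 0 (2 * C) (|Ω - Ω₀| * R) T :=
      (gronwallBound_continuous_ε 0 (2 * C) T).comp (by fun_prop)
    simpa [gronwallBound_ε0_δ0] using hc.tendsto Ω₀
  exact tendsto_iff_dist_tendsto_zero.2
    (squeeze_zero (fun _ => dist_nonneg) hbound hlim)

/-! ### Levels that the angle crosses in one direction only -/

/-- A function whose derivative is positive wherever it takes the value `c` exceeds `c` forever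
once it has reached `c`. -/
lemma lt_of_deriv_pos_on_level {f f' : ℝ → ℝ} {a c : ℝ} (hf : ∀ t, HasDerivAt f (f' t) t)
    (hlevel : ∀ t ≥ a, f t = c → 0 < f' t) (ha : c ≤ f a) {t : ℝ} (ht : a < t) : c < f t := by
  have hle : ∀ x ∈ Icc a t, c ≤ f x :=
    image_le_of_deriv_right_lt_deriv_boundary' (f := fun _ => c) (f' := fun _ => 0)
      continuousOn_const (fun x _ => hasDerivWithinAt_const _ _ _) ha
      (fun x _ => (hf x).continuousAt.continuousWithinAt) (fun x _ => (hf x).hasDerivWithinAt)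
      (fun x hx h => hlevel x hx.1 h.symm)
  refine lt_of_le_of_ne (hle t ⟨ht.le, le_rfl⟩) fun h => ?_
  -- At `t` the function has a minimum on `[a, t]`, so its derivative there is not positive.
  have hpos := hlevel t ht.le h.symm
  have hev : ∀ᶠ x in 𝓝[<] t, f x < f t := by
    have h1 := ((hasDerivAt_iff_tendsto_slope.1 (hf t)).mono_left
      (nhdsWithin_mono t (fun x (hx : x < t) => hx.ne))).eventually (lt_mem_nhds hpos)
    filter_upwards [h1, self_mem_nhdsWithin] with x hx (hxt : x < t)
    rw [slope_def_field] at hx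
    by_contra hcon
    exact hx.not_ge (div_nonpos_of_nonneg_of_nonpos (by linarith) (by linarith))
  obtain ⟨x, hx, hxm⟩ := (hev.and (Ioo_mem_nhdsLT ht)).exists
  linarith [hle x ⟨hxm.1.le, hxm.2.le⟩]

lemma gt_of_deriv_neg_on_level {f f' : ℝ → ℝ} {a c : ℝ} (hf : ∀ t, HasDerivAt f (f' t) t)
    (hlevel : ∀ t ≥ a, f t = c → f' t < 0) (ha : f a ≤ c) {t : ℝ} (ht : a < t) : f t < c :=
  neg_lt_neg_iff.1 (lt_of_deriv_pos_on_level (f := fun x => -f x) (f' := fun x => -f' x) (c := -c)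
    (fun x => (hf x).fun_neg) (fun x hx h => neg_pos.2 (hlevel x hx (neg_inj.1 h)))
    (neg_le_neg ha) ht)

/-- The angle crosses the multiples of `π` upwards only. -/
theorem IsPruferSolution.nat_mul_pi_lt {p q φ : ℝ → ℝ} (h : IsPruferSolution p q φ)
    (hp : ∀ t, 0 < p t) (k : ℕ) {a t : ℝ} (ha : k * Real.pi ≤ φ a) (ht : a < t) :
    k * Real.pi < φ t := by
  refine lt_of_deriv_pos_on_level h.hasDeriv (fun s _ hs => ?_) ha ht
  simp only [pruferField, hs, Real.sin_nat_mul_pi]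
  have h1 : Real.cos (k * Real.pi) ^ 2 = 1 := by
    have := Real.sin_sq_add_cos_sq (k * Real.pi)
    simpa using this
  simpa [h1] using hp s

/-- Where `q < 0`, the angle crosses the odd multiples of `π / 2` downwards only. -/
theorem IsPruferSolution.lt_nat_sub_half_mul_pi {p q φ : ℝ → ℝ} (h : IsPruferSolution p q φ)
    (k : ℕ) {a t : ℝ} (hq : ∀ t ≥ a, q t < 0) (ha : φ a ≤ ((k : ℝ) - 1 / 2) * Real.pi)
    (ht : a < t) : φ t < ((k : ℝ) - 1 / 2) * Real.pi := by
  refine gt_of_deriv_neg_on_level h.hasDeriv (fun s hs hsφ => ?_) ha ht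
  have hcos : Real.cos (((k : ℝ) - 1 / 2) * Real.pi) = 0 := by
    rw [show ((k : ℝ) - 1 / 2) * Real.pi = k * Real.pi - Real.pi / 2 by ring,
      Real.cos_sub_pi_div_two, Real.sin_nat_mul_pi]
  have h1 : Real.sin (((k : ℝ) - 1 / 2) * Real.pi) ^ 2 = 1 := by
    have := Real.sin_sq_add_cos_sq (((k : ℝ) - 1 / 2) * Real.pi)
    rw [hcos] at this
    linarith
  simp only [pruferField, hsφ, hcos, h1]
  simpa using hq s hs

/-! ### The solution with a given Prüfer angle -/

/-- The modulus of `(w, u)` when the polar angle is `φ`, normalized to `1` at `0`. -/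
noncomputable def pruferModulus (p q φ : ℝ → ℝ) (t : ℝ) : ℝ :=
  Real.exp (∫ s in (0 : ℝ)..t, (p s - q s) * (Real.sin (φ s) * Real.cos (φ s)))

/-- The component `u` of the solution with Prüfer angle `φ`. -/
noncomputable def pruferU (p q φ : ℝ → ℝ) (t : ℝ) : ℝ := pruferModulus p q φ t * Real.sin (φ t)

/-- The component `w` of the solution with Prüfer angle `φ`. -/
noncomputable def pruferW (p q φ : ℝ → ℝ) (t : ℝ) : ℝ := pruferModulus p q φ t * Real.cos (φ t)

lemma pruferModulus_pos (p q φ : ℝ → ℝ) (t : ℝ) : 0 < pruferModulus p q φ t := Real.exp_pos _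

lemma sqrt_pruferU_sq_add_pruferW_sq (p q φ : ℝ → ℝ) (t : ℝ) :
    Real.sqrt (pruferU p q φ t ^ 2 + pruferW p q φ t ^ 2) = pruferModulus p q φ t := by
  rw [pruferU, pruferW, mul_pow, mul_pow, ← mul_add, Real.sin_sq_add_cos_sq, mul_one,
    Real.sqrt_sq (pruferModulus_pos p q φ t).le]

section Solution

variable {p q φ : ℝ → ℝ}

lemma IsPruferSolution.hasDerivAt_modulus (hp : Continuous p) (hq : Continuous q)
    (h : IsPruferSolution p q φ) (t : ℝ) :
    HasDerivAt (pruferModulus p q φ)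
      (pruferModulus p q φ t * ((p t - q t) * (Real.sin (φ t) * Real.cos (φ t)))) t := by
  have hφ := h.continuous
  exact (hasDerivAt_integral_of_continuous
    (f := fun s => (p s - q s) * (Real.sin (φ s) * Real.cos (φ s))) (by fun_prop) t).exp

lemma IsPruferSolution.hasDerivAt_pruferU (hp : Continuous p) (hq : Continuous q)
    (h : IsPruferSolution p q φ) (t : ℝ) :
    HasDerivAt (pruferU p q φ) (p t * pruferW p q φ t) t := by
  refine ((h.hasDerivAt_modulus hp hq t).mul (h.hasDeriv t).sin).congr_deriv ?_
  have := Real.sin_sq_add_cos_sq (φ t)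
  simp only [pruferW, pruferField]
  linear_combination p t * pruferModulus p q φ t * Real.cos (φ t) * this

lemma IsPruferSolution.hasDerivAt_pruferW (hp : Continuous p) (hq : Continuous q)
    (h : IsPruferSolution p q φ) (t : ℝ) :
    HasDerivAt (pruferW p q φ) (-(q t * pruferU p q φ t)) t := by
  refine ((h.hasDerivAt_modulus hp hq t).mul (h.hasDeriv t).cos).congr_deriv ?_
  have := Real.sin_sq_add_cos_sq (φ t)
  simp only [pruferU, pruferField]
  linear_combination (-(q t * pruferModulus p q φ t * Real.sin (φ t))) * this

lemma IsPruferSolution.pruferU_zero (h : IsPruferSolution p q φ) : pruferU p q φ 0 = 1 := by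
  simp [pruferU, pruferModulus, h.initial]

lemma IsPruferSolution.pruferW_zero (h : IsPruferSolution p q φ) : pruferW p q φ 0 = 0 := by
  simp [pruferW, h.initial]

lemma IsPruferSolution.isPruferAngle (h : IsPruferSolution p q φ) :
    IsPruferAngle (pruferU p q φ) (pruferW p q φ) φ where
  continuousOn := h.continuous.continuousOn
  initial := h.initial
  cos_eq y _ := by rw [sqrt_pruferU_sq_add_pruferW_sq]; rfl
  sin_eq y _ := by rw [sqrt_pruferU_sq_add_pruferW_sq]; rfl

lemma IsPruferSolution.isSLSolution {μ : ℝ → ℝ} (hp : Continuous fun t => (μ t)⁻¹)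
    (hq : Continuous q) (h : IsPruferSolution (fun t => (μ t)⁻¹) q φ) :
    IsSLSolution μ q (pruferU (fun t => (μ t)⁻¹) q φ) (pruferW (fun t => (μ t)⁻¹) q φ) where
  hasDeriv_u y _ :=
    ((h.hasDerivAt_pruferU hp hq y).congr_deriv (by rw [inv_mul_eq_div])).hasDerivWithinAt
  hasDeriv_w y _ := (h.hasDerivAt_pruferW hp hq y).hasDerivWithinAt

end Solution

/-! ### Uniqueness for the linear problem and for the Prüfer angle -/

lemma IsSLSolution.const_mul {μ γ u w : ℝ → ℝ} (h : IsSLSolution μ γ u w) (c : ℝ) :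
    IsSLSolution μ γ (fun y => c * u y) (fun y => c * w y) where
  hasDeriv_u y hy := ((h.hasDeriv_u y hy).const_mul c).congr_deriv (by ring)
  hasDeriv_w y hy := ((h.hasDeriv_w y hy).const_mul c).congr_deriv (by ring)

/-- Solutions of the initial value problem are unique on `[0, ∞)`. -/
lemma IsSLSolution.eq_of_initial {μ γ u₁ w₁ u₂ w₂ : ℝ → ℝ} (hμ : Continuous fun t => (μ t)⁻¹)
    (hγ : Continuous γ) (h₁ : IsSLSolution μ γ u₁ w₁) (h₂ : IsSLSolution μ γ u₂ w₂)
    (hu : u₁ 0 = u₂ 0) (hw : w₁ 0 = w₂ 0) {y : ℝ} (hy : y ∈ Ici (0 : ℝ)) :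
    u₁ y = u₂ y ∧ w₁ y = w₂ y := by
  obtain ⟨C, hC⟩ := exists_abs_le_Icc hμ hγ 0 y
  have hder : ∀ {u w : ℝ → ℝ}, IsSLSolution μ γ u w → ∀ t ∈ Ici (0 : ℝ),
      HasDerivWithinAt (fun t => (u t, w t)) (w t / μ t, -(γ t * u t)) (Ici t) t := by
    intro u w h t ht
    have hsub : Ici t ⊆ Ici (0 : ℝ) := Ici_subset_Ici.2 ht
    exact ((h.hasDeriv_u t ht).mono hsub).prodMk ((h.hasDeriv_w t ht).mono hsub)
  have hcont : ∀ {u w : ℝ → ℝ}, IsSLSolution μ γ u w →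
      ContinuousOn (fun t => (u t, w t)) (Icc 0 y) := by
    intro u w h
    refine ContinuousOn.mono (s := Ici 0) ?_ Icc_subset_Ici_self
    exact ContinuousOn.prodMk (fun t ht => (h.hasDeriv_u t ht).continuousWithinAt)
      (fun t ht => (h.hasDeriv_w t ht).continuousWithinAt)
  have key := ODE_solution_unique_of_mem_Icc_right (K := C) (s := fun _ => univ) (a := 0) (b := y)
    (v := fun t (z : ℝ × ℝ) => (z.2 / μ t, -(γ t * z.1)))
    (f := fun t => (u₁ t, w₁ t)) (g := fun t => (u₂ t, w₂ t)) (fun t ht => ?_)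
    (hcont h₁) (fun t ht => hder h₁ t ht.1) (fun _ _ => trivial)
    (hcont h₂) (fun t ht => hder h₂ t ht.1) (fun _ _ => trivial) (by simp [hu, hw])
    ⟨hy, le_rfl⟩
  · exact Prod.mk.inj key
  · refine LipschitzOnWith.of_dist_le_mul fun x _ z _ => ?_
    obtain ⟨h1, h2⟩ := hC t (Ico_subset_Icc_self ht)
    rw [Prod.dist_eq, Prod.dist_eq]
    refine max_le ?_ ?_
    · rw [Real.dist_eq, ← sub_div, div_eq_inv_mul, abs_mul]
      exact mul_le_mul h1 (le_max_right _ _) (abs_nonneg _) C.2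
    · rw [Real.dist_eq, neg_sub_neg, ← mul_sub, abs_mul, abs_sub_comm]
      exact mul_le_mul h2 (le_max_left _ _) (abs_nonneg _) C.2

/-- Two continuous branches of the same angle that agree at `0` agree on `[0, ∞)`. -/
lemma eqOn_of_cos_sub_eq_one {φ ψ : ℝ → ℝ} (hφ : ContinuousOn φ (Ici 0))
    (hψ : ContinuousOn ψ (Ici 0)) (h0 : φ 0 = ψ 0)
    (hcos : ∀ y ∈ Ici (0 : ℝ), Real.cos (φ y - ψ y) = 1) : EqOn φ ψ (Ici 0) := by
  intro y hy
  by_contra hne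
  set d : ℝ → ℝ := fun t => |φ t - ψ t| with hd
  have hdc : ContinuousOn d (Icc 0 y) := ((hφ.sub hψ).abs).mono Icc_subset_Ici_self
  have hdy : 0 < d y := abs_pos.2 (sub_ne_zero.2 hne)
  have hpi := Real.pi_pos
  -- `d` attains a value in `(0, π]`, where the cosine is less than `1`.
  obtain ⟨t, ht, hdt⟩ := intermediate_value_Icc hy hdc
    (show min (d y) Real.pi ∈ Icc (d 0) (d y) by
      refine ⟨?_, min_le_left _ _⟩
      simp only [hd, h0, sub_self, abs_zero]
      exact (lt_min hdy hpi).le)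
  have h1 : 0 < d t := hdt ▸ lt_min hdy hpi
  have h2 : d t ≤ Real.pi := hdt ▸ min_le_right _ _
  have h3 := hcos t ht.1
  rw [← Real.cos_abs] at h3
  have := (Real.cos_eq_one_iff_of_lt_of_lt (by simp only [hd] at h1; linarith)
    (by simp only [hd] at h2; linarith)).1 h3
  exact h1.ne' this

/-- A nontrivial solution with `w 0 = 0` that has a Prüfer angle is a positive multiple of the
solution constructed from the Prüfer equation, with the same angle. -/
theorem IsPruferSolution.eq_const_mul {μ γ φ u w ψ : ℝ → ℝ} (hμ : Continuous fun t => (μ t)⁻¹)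
    (hγ : Continuous γ) (h : IsPruferSolution (fun t => (μ t)⁻¹) γ φ)
    (hs : IsSLSolution μ γ u w) (hnt : NontrivialOnHalfLine u) (hw0 : w 0 = 0)
    (hψ : IsPruferAngle u w ψ) :
    ∃ c : ℝ, 0 < c ∧ (∀ y ∈ Ici (0 : ℝ), u y = c * pruferU (fun t => (μ t)⁻¹) γ φ y ∧
      w y = c * pruferW (fun t => (μ t)⁻¹) γ φ y) ∧ EqOn φ ψ (Ici 0) := by
  have heq : ∀ y ∈ Ici (0 : ℝ), u y = u 0 * pruferU (fun t => (μ t)⁻¹) γ φ y ∧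
      w y = u 0 * pruferW (fun t => (μ t)⁻¹) γ φ y := fun y hy =>
    hs.eq_of_initial hμ hγ ((h.isSLSolution hμ hγ).const_mul (u 0)) (by simp [h.pruferU_zero])
      (by simp [h.pruferW_zero, hw0]) hy
  have hc : 0 < u 0 := by
    refine lt_of_le_of_ne ?_ fun h0 => ?_
    · rw [hψ.sin_eq 0 self_mem_Ici, hψ.initial, Real.sin_pi_div_two, mul_one]
      exact Real.sqrt_nonneg _
    · obtain ⟨y, hy, hne⟩ := hnt
      exact hne (by rw [(heq y hy).1, ← h0, zero_mul])
  refine ⟨u 0, hc, heq, eqOn_of_cos_sub_eq_one h.continuous.continuousOn hψ.continuousOn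
    (h.initial.trans hψ.initial.symm) fun y hy => ?_⟩
  have hr : 0 < u 0 * pruferModulus (fun t => (μ t)⁻¹) γ φ y :=
    mul_pos hc (pruferModulus_pos _ _ _ _)
  have hsqrt : Real.sqrt (u y ^ 2 + w y ^ 2)
      = u 0 * pruferModulus (fun t => (μ t)⁻¹) γ φ y := by
    rw [(heq y hy).1, (heq y hy).2, mul_pow, mul_pow, ← mul_add, Real.sqrt_mul (sq_nonneg _),
      Real.sqrt_sq hc.le, sqrt_pruferU_sq_add_pruferW_sq]
  have hsin := hψ.sin_eq y hy
  have hcos := hψ.cos_eq y hy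
  rw [hsqrt, (heq y hy).1, pruferU, ← mul_assoc] at hsin
  rw [hsqrt, (heq y hy).2, pruferW, ← mul_assoc] at hcos
  rw [Real.cos_sub, mul_left_cancel₀ hr.ne' hsin, mul_left_cancel₀ hr.ne' hcos, ← sq, ← sq,
    Real.cos_sq_add_sin_sq]

/-! ### Growth and decay -/

section Decay

variable {p q u w : ℝ → ℝ}

lemma hasDerivAt_mul_solution (hu : ∀ t, HasDerivAt u (p t * w t) t)
    (hw : ∀ t, HasDerivAt w (-(q t * u t)) t) (t : ℝ) :
    HasDerivAt (fun t => u t * w t) (p t * w t ^ 2 - q t * u t ^ 2) t :=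
  ((hu t).mul (hw t)).congr_deriv (by ring)

lemma monotoneOn_Ici_of_hasDerivAt {f f' : ℝ → ℝ} {a : ℝ} (hf : ∀ t, HasDerivAt f (f' t) t)
    (h : ∀ t ≥ a, 0 ≤ f' t) : MonotoneOn f (Ici a) :=
  monotoneOn_of_hasDerivWithinAt_nonneg (convex_Ici a)
    (fun t _ => (hf t).continuousAt.continuousWithinAt) (fun t _ => (hf t).hasDerivWithinAt)
    (fun t ht => h t (interior_subset ht))

lemma antitoneOn_Ici_of_hasDerivAt {f f' : ℝ → ℝ} {a : ℝ} (hf : ∀ t, HasDerivAt f (f' t) t)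
    (h : ∀ t ≥ a, f' t ≤ 0) : AntitoneOn f (Ici a) :=
  antitoneOn_of_hasDerivWithinAt_nonpos (convex_Ici a)
    (fun t _ => (hf t).continuousAt.continuousWithinAt) (fun t _ => (hf t).hasDerivWithinAt)
    (fun t ht => h t (interior_subset ht))

/-- If `q ≤ 0` throughout, then `u w` is nondecreasing, hence nonnegative, and `u ^ 2` does not
decrease. -/
lemma not_tendsto_zero_of_nonpos (hp : ∀ t, 0 < p t) (hu : ∀ t, HasDerivAt u (p t * w t) t)
    (hw : ∀ t, HasDerivAt w (-(q t * u t)) t) (hq : ∀ t ≥ 0, q t ≤ 0) (hw0 : w 0 = 0)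
    (hu0 : u 0 ≠ 0) : ¬ Tendsto u atTop (𝓝 0) := by
  intro hlim
  have h1 : MonotoneOn (fun t => u t * w t) (Ici 0) :=
    monotoneOn_Ici_of_hasDerivAt (hasDerivAt_mul_solution hu hw) fun t ht => by
      have := mul_nonneg (hp t).le (sq_nonneg (w t))
      have := mul_nonpos_of_nonpos_of_nonneg (hq t ht) (sq_nonneg (u t))
      linarith
  have h2 : MonotoneOn (fun t => u t ^ 2) (Ici 0) :=
    monotoneOn_Ici_of_hasDerivAt (fun t => (hu t).pow 2) fun t ht => by
      have h3 : 0 ≤ u t * w t := by simpa [hw0] using h1 self_mem_Ici ht ht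
      have := mul_nonneg (hp t).le h3
      norm_num
      linarith
  have h3 : u 0 ^ 2 ≤ 0 ^ 2 :=
    ge_of_tendsto (hlim.pow 2) (by
      filter_upwards [eventually_ge_atTop 0] with t ht using h2 self_mem_Ici ht ht)
  exact hu0 (by simpa using h3)

/-- If `q` is negative and bounded away from `0` near infinity and `u w ≤ 0` there, then `u ^ 2`
decreases to `0`: otherwise `(u w)'` would be bounded below by a positive constant. -/
lemma tendsto_zero_of_mul_nonpos (hp : ∀ t, 0 < p t) (hu : ∀ t, HasDerivAt u (p t * w t) t)
    (hw : ∀ t, HasDerivAt w (-(q t * u t)) t) {Y δ : ℝ} (hδ : 0 < δ)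
    (hq : ∀ t ≥ Y, q t ≤ -δ) (huw : ∀ t ≥ Y, u t * w t ≤ 0) : Tendsto u atTop (𝓝 0) := by
  have hanti : AntitoneOn (fun t => u t ^ 2) (Ici Y) :=
    antitoneOn_Ici_of_hasDerivAt (fun t => (hu t).pow 2) fun t ht => by
      have := mul_nonpos_of_nonneg_of_nonpos (hp t).le (huw t ht)
      norm_num
      linarith
  rw [Metric.tendsto_atTop]
  intro ε hε
  by_cases hcase : ∃ t ≥ Y, u t ^ 2 < ε ^ 2
  · obtain ⟨t, htY, ht⟩ := hcase
    refine ⟨t, fun s hs => ?_⟩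
    rw [Real.dist_eq, sub_zero]
    exact abs_lt_of_sq_lt_sq ((hanti htY (htY.trans hs) hs).trans_lt ht) hε.le
  · exfalso
    push Not at hcase
    have hmono : MonotoneOn (fun t => u t * w t - δ * ε ^ 2 * t) (Ici Y) :=
      monotoneOn_Ici_of_hasDerivAt (fun t => (hasDerivAt_mul_solution hu hw t).sub
        ((hasDerivAt_id t).const_mul (δ * ε ^ 2))) fun t ht => by
        have h1 := mul_nonneg (hp t).le (sq_nonneg (w t))
        have h2 := mul_le_mul_of_nonneg_right (hq t ht) (sq_nonneg (u t))
        have h3 := mul_le_mul_of_nonneg_left (hcase t ht) hδ.le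
        linarith
    have hc : 0 < δ * ε ^ 2 := by positivity
    set s : ℝ := Y + (1 - u Y * w Y) / (δ * ε ^ 2) with hs
    have hYs : Y ≤ s := by
      have : 0 ≤ (1 - u Y * w Y) / (δ * ε ^ 2) :=
        div_nonneg (by linarith [huw Y le_rfl]) hc.le
      linarith
    have h1 : u Y * w Y - δ * ε ^ 2 * Y ≤ u s * w s - δ * ε ^ 2 * s := hmono self_mem_Ici hYs hYs
    have h2 : δ * ε ^ 2 * (s - Y) = 1 - u Y * w Y := by rw [hs]; field_simp; ring
    have h3 := huw s hYs
    linarith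

lemma exists_abs_le_of_mul_nonpos (hw : ∀ t, HasDerivAt w (-(q t * u t)) t) {Y : ℝ}
    (hq : ∀ t ≥ Y, q t ≤ 0) (huw : ∀ t ≥ Y, u t * w t ≤ 0) : ∀ t ≥ Y, |w t| ≤ |w Y| := by
  have hanti : AntitoneOn (fun t => w t ^ 2) (Ici Y) :=
    antitoneOn_Ici_of_hasDerivAt (fun t => (hw t).pow 2) fun t ht => by
      have := mul_nonneg_of_nonpos_of_nonpos (hq t ht) (huw t ht)
      norm_num
      linarith
  exact fun t ht => sq_le_sq.1 (hanti self_mem_Ici ht ht)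

end Decay

/-! ### Solutions whose angle stays in a sector -/

lemma sin_mul_sin_nonneg_of_mem_sector {m : ℕ} {x y : ℝ}
    (hx : x ∈ Icc (((m : ℝ) - 1 / 2) * Real.pi) (m * Real.pi))
    (hy : y ∈ Icc (((m : ℝ) - 1 / 2) * Real.pi) (m * Real.pi)) :
    0 ≤ Real.sin x * Real.sin y := by
  have key : ∀ {z : ℝ}, z ∈ Icc (((m : ℝ) - 1 / 2) * Real.pi) (m * Real.pi) →
      0 ≤ Real.sin (m * Real.pi - z) := fun hz =>
    Real.sin_nonneg_of_nonneg_of_le_pi (by linarith [hz.2]) (by linarith [hz.1, Real.pi_pos])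
  have h := mul_nonneg (key hx) (key hy)
  rw [Real.sin_nat_mul_pi_sub, Real.sin_nat_mul_pi_sub, neg_mul_neg, mul_mul_mul_comm,
    ← mul_pow] at h
  simpa using h

lemma sin_mul_cos_nonpos_of_mem_sector {m : ℕ} {x : ℝ}
    (hx : x ∈ Icc (((m : ℝ) - 1 / 2) * Real.pi) (m * Real.pi)) :
    Real.sin x * Real.cos x ≤ 0 := by
  have h1 : 0 ≤ Real.sin (m * Real.pi - x) :=
    Real.sin_nonneg_of_nonneg_of_le_pi (by linarith [hx.2]) (by linarith [hx.1, Real.pi_pos])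
  have h2 : 0 ≤ Real.cos (m * Real.pi - x) :=
    Real.cos_nonneg_of_neg_pi_div_two_le_of_le (by linarith [hx.2, Real.pi_pos])
      (by linarith [hx.1])
  have h := mul_nonneg h1 h2
  rw [Real.sin_nat_mul_pi_sub, Real.cos_nat_mul_pi_sub, neg_mul, mul_mul_mul_comm,
    ← mul_pow] at h
  simpa using h

lemma pruferU_mul_pruferW_nonpos {p q φ : ℝ → ℝ} {m : ℕ} {t : ℝ}
    (h : φ t ∈ Icc (((m : ℝ) - 1 / 2) * Real.pi) (m * Real.pi)) :
    pruferU p q φ t * pruferW p q φ t ≤ 0 := by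
  rw [pruferU, pruferW, mul_mul_mul_comm]
  exact mul_nonpos_of_nonneg_of_nonpos (mul_self_nonneg _) (sin_mul_cos_nonpos_of_mem_sector h)

theorem IsPruferSolution.tendsto_pruferU {p q φ : ℝ → ℝ} (hpc : Continuous p) (hqc : Continuous q)
    (hp : ∀ t, 0 < p t) (h : IsPruferSolution p q φ) {δ : ℝ} (hδ : 0 < δ)
    (hq : ∀ᶠ t in atTop, q t ≤ -δ) {m : ℕ}
    (hm : ∀ᶠ t in atTop, φ t ∈ Icc (((m : ℝ) - 1 / 2) * Real.pi) (m * Real.pi)) :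
    Tendsto (pruferU p q φ) atTop (𝓝 0) := by
  obtain ⟨Y, hY⟩ := eventually_atTop.1 (hq.and hm)
  exact tendsto_zero_of_mul_nonpos hp (h.hasDerivAt_pruferU hpc hqc)
    (h.hasDerivAt_pruferW hpc hqc) hδ (fun t ht => (hY t ht).1)
    fun t ht => pruferU_mul_pruferW_nonpos (hY t ht).2

/-- For two ordered coefficients, decaying solutions cannot end in the same sector: their
Wronskian `w₁ u₂ - u₁ w₂` is eventually positive and nondecreasing, but tends to `0`. -/
theorem IsPruferSolution.not_same_sector {p q₁ q₂ φ₁ φ₂ : ℝ → ℝ} (hpc : Continuous p)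
    (hqc₁ : Continuous q₁) (hqc₂ : Continuous q₂)
    (h₁ : IsPruferSolution p q₁ φ₁) (h₂ : IsPruferSolution p q₂ φ₂)
    (hle : ∀ t ≥ 0, q₁ t ≤ q₂ t) (hlt : q₁ 0 < q₂ 0) (hq : ∀ᶠ t in atTop, q₂ t ≤ 0)
    (hu₁ : Tendsto (pruferU p q₁ φ₁) atTop (𝓝 0)) (hu₂ : Tendsto (pruferU p q₂ φ₂) atTop (𝓝 0))
    {m : ℕ} (hm₁ : ∀ᶠ t in atTop, φ₁ t ∈ Icc (((m : ℝ) - 1 / 2) * Real.pi) (m * Real.pi))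
    (hm₂ : ∀ᶠ t in atTop, φ₂ t ∈ Icc (((m : ℝ) - 1 / 2) * Real.pi) (m * Real.pi)) : False := by
  obtain ⟨Y, hY⟩ := eventually_atTop.1
    (hq.and (hm₁.and (hm₂.and (eventually_gt_atTop (0 : ℝ)))))
  have hbdd₁ : ∀ᶠ t in atTop, |pruferW p q₁ φ₁ t| ≤ |pruferW p q₁ φ₁ Y| :=
    eventually_atTop.2 ⟨Y, exists_abs_le_of_mul_nonpos (h₁.hasDerivAt_pruferW hpc hqc₁)
      (fun t ht => (hle t (hY t ht).2.2.2.le).trans (hY t ht).1)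
      fun t ht => pruferU_mul_pruferW_nonpos (hY t ht).2.1⟩
  have hbdd₂ : ∀ᶠ t in atTop, |pruferW p q₂ φ₂ t| ≤ |pruferW p q₂ φ₂ Y| :=
    eventually_atTop.2 ⟨Y, exists_abs_le_of_mul_nonpos (h₂.hasDerivAt_pruferW hpc hqc₂)
      (fun t ht => (hY t ht).1) fun t ht => pruferU_mul_pruferW_nonpos (hY t ht).2.2.1⟩
  set W : ℝ → ℝ := fun t =>
    pruferW p q₁ φ₁ t * pruferU p q₂ φ₂ t - pruferW p q₂ φ₂ t * pruferU p q₁ φ₁ t with hW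
  have hlim : Tendsto W atTop (𝓝 0) := by
    simpa using (bdd_le_mul_tendsto_zero' _ hbdd₁ hu₂).sub (bdd_le_mul_tendsto_zero' _ hbdd₂ hu₁)
  have hmono : MonotoneOn W (Ici Y) := by
    refine monotoneOn_Ici_of_hasDerivAt
      (f' := fun t => (q₂ t - q₁ t) * (pruferU p q₁ φ₁ t * pruferU p q₂ φ₂ t))
      (fun t => ?_) fun t ht => ?_
    · refine (((h₁.hasDerivAt_pruferW hpc hqc₁ t).mul (h₂.hasDerivAt_pruferU hpc hqc₂ t)).sub
        ((h₂.hasDerivAt_pruferW hpc hqc₂ t).mul (h₁.hasDerivAt_pruferU hpc hqc₁ t))).congr_deriv ?_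
      ring
    · refine mul_nonneg (sub_nonneg.2 (hle t (hY t ht).2.2.2.le)) ?_
      rw [pruferU, pruferU, mul_mul_mul_comm]
      exact mul_nonneg (mul_pos (pruferModulus_pos _ _ _ _) (pruferModulus_pos _ _ _ _)).le
        (sin_mul_sin_nonneg_of_mem_sector (hY t ht).2.1 (hY t ht).2.2.1)
  have hpos : 0 < W Y := by
    have hφ := h₁.lt_of_le hpc hqc₂ h₂ hle hlt (hY Y le_rfl).2.2.2
    have hsin : 0 < Real.sin (φ₂ Y - φ₁ Y) :=
      Real.sin_pos_of_pos_of_lt_pi (sub_pos.2 hφ)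
        (by linarith [(hY Y le_rfl).2.1.1, (hY Y le_rfl).2.2.1.2, Real.pi_pos])
    have := mul_pos (mul_pos (pruferModulus_pos p q₁ φ₁ Y) (pruferModulus_pos p q₂ φ₂ Y)) hsin
    rw [Real.sin_sub] at this
    simp only [hW, pruferU, pruferW]
    linarith
  have : W Y ≤ 0 := ge_of_tendsto hlim (eventually_atTop.2 ⟨Y, fun t ht => hmono self_mem_Ici ht ht⟩)
  linarith

/-! ### The parametric family -/

/-- Coefficients `ρ`, `μ` that are continuous and positive on the whole line and have positive
limits at infinity, together with the Prüfer angles `Φ Ω` of the equations with coefficients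
`Ω ρ - K μ`. -/
structure IsPruferFamily (ρ μ : ℝ → ℝ) (ρinf μinf K : ℝ) (Φ : ℝ → ℝ → ℝ) : Prop where
  continuous_rho : Continuous ρ
  continuous_mu : Continuous μ
  rho_pos : ∀ t, 0 < ρ t
  mu_pos : ∀ t, 0 < μ t
  rhoInf_pos : 0 < ρinf
  muInf_pos : 0 < μinf
  rho_tendsto : Tendsto ρ atTop (𝓝 ρinf)
  mu_tendsto : Tendsto μ atTop (𝓝 μinf)
  K_pos : 0 < K
  angle : ∀ Ω, IsPruferSolution (fun t => (μ t)⁻¹) (gammaCoeff ρ μ K Ω) (Φ Ω)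

namespace IsPruferFamily

variable {ρ μ : ℝ → ℝ} {ρinf μinf K : ℝ} {Φ : ℝ → ℝ → ℝ}

lemma continuous_inv_mu (h : IsPruferFamily ρ μ ρinf μinf K Φ) : Continuous fun t => (μ t)⁻¹ :=
  h.continuous_mu.inv₀ fun t => (h.mu_pos t).ne'

lemma inv_mu_pos (h : IsPruferFamily ρ μ ρinf μinf K Φ) (t : ℝ) : 0 < (μ t)⁻¹ :=
  inv_pos.2 (h.mu_pos t)

lemma continuous_gammaCoeff (h : IsPruferFamily ρ μ ρinf μinf K Φ) (Ω : ℝ) :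
    Continuous (gammaCoeff ρ μ K Ω) := by
  have := h.continuous_rho
  have := h.continuous_mu
  unfold gammaCoeff
  fun_prop

lemma gammaCoeff_lt (h : IsPruferFamily ρ μ ρinf μinf K Φ) {Ω₁ Ω₂ : ℝ} (hlt : Ω₁ < Ω₂) (t : ℝ) :
    gammaCoeff ρ μ K Ω₁ t < gammaCoeff ρ μ K Ω₂ t :=
  sub_lt_sub_right (mul_lt_mul_of_pos_right hlt (h.rho_pos t)) _

lemma continuous_param (h : IsPruferFamily ρ μ ρinf μinf K Φ) {t : ℝ} (ht : 0 ≤ t) :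
    Continuous fun Ω => Φ Ω t :=
  continuous_pruferAngle_param (κ := fun s => K * μ s) h.continuous_inv_mu h.continuous_rho
    (h.continuous_mu.const_mul K) h.angle ht

lemma angle_mono (h : IsPruferFamily ρ μ ρinf μinf K Φ) {Ω₁ Ω₂ : ℝ} (hle : Ω₁ ≤ Ω₂) {t : ℝ}
    (ht : 0 < t) : Φ Ω₁ t ≤ Φ Ω₂ t := by
  rcases hle.eq_or_lt with rfl | hlt
  · exact le_rfl
  · exact ((h.angle Ω₁).lt_of_le h.continuous_inv_mu (h.continuous_gammaCoeff Ω₂) (h.angle Ω₂)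
      (fun s _ => (h.gammaCoeff_lt hlt s).le) (h.gammaCoeff_lt hlt 0) ht).le

/-- Below the limiting value of `Ω`, the coefficient is eventually bounded above by a negative
constant. -/
lemma exists_eventually_gammaCoeff_le (h : IsPruferFamily ρ μ ρinf μinf K Φ) {Ω : ℝ}
    (hΩ : Ω < μinf / ρinf * K) : ∃ δ > 0, ∀ᶠ t in atTop, gammaCoeff ρ μ K Ω t ≤ -δ := by
  have hlim : Tendsto (gammaCoeff ρ μ K Ω) atTop (𝓝 (Ω * ρinf - K * μinf)) :=
    (h.rho_tendsto.const_mul Ω).sub (h.mu_tendsto.const_mul K)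
  have hneg : Ω * ρinf - K * μinf < 0 := by
    rw [div_mul_eq_mul_div, lt_div_iff₀ h.rhoInf_pos] at hΩ
    linarith
  refine ⟨-((Ω * ρinf - K * μinf) / 2), by linarith, ?_⟩
  have hhalf : Ω * ρinf - K * μinf < (Ω * ρinf - K * μinf) / 2 := by linarith
  filter_upwards [hlim.eventually (gt_mem_nhds hhalf)] with t ht
  linarith

lemma exists_forall_gammaCoeff_neg (h : IsPruferFamily ρ μ ρinf μinf K Φ) {Ω : ℝ}
    (hΩ : Ω < μinf / ρinf * K) : ∃ Y ≥ 0, ∀ t ≥ Y, gammaCoeff ρ μ K Ω t < 0 := by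
  obtain ⟨δ, hδ, hev⟩ := h.exists_eventually_gammaCoeff_le hΩ
  obtain ⟨Y, hY⟩ := eventually_atTop.1 hev
  exact ⟨max Y 0, le_max_right _ _, fun t ht =>
    (hY t ((le_max_left _ _).trans ht)).trans_lt (neg_lt_zero.2 hδ)⟩

/-- Below the limiting value of `Ω`, the Prüfer angle is bounded. -/
lemma exists_eventually_angle_lt (h : IsPruferFamily ρ μ ρinf μinf K Φ) {Ω : ℝ}
    (hΩ : Ω < μinf / ρinf * K) :
    ∃ k : ℕ, ∀ᶠ t in atTop, Φ Ω t < ((k : ℝ) - 1 / 2) * Real.pi := by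
  obtain ⟨Y, -, hY⟩ := h.exists_forall_gammaCoeff_neg hΩ
  obtain ⟨k, hk⟩ := exists_nat_ge (Φ Ω Y / Real.pi + 1 / 2)
  refine ⟨k, (eventually_gt_atTop Y).mono fun t ht =>
    (h.angle Ω).lt_nat_sub_half_mul_pi k hY ?_ ht⟩
  rw [← div_le_iff₀ Real.pi_pos]
  linarith

lemma nat_mul_pi_lt (h : IsPruferFamily ρ μ ρinf μinf K Φ) {Ω : ℝ} {k : ℕ} {y t : ℝ}
    (hy : k * Real.pi ≤ Φ Ω y) (ht : y < t) : k * Real.pi < Φ Ω t :=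
  (h.angle Ω).nat_mul_pi_lt h.inv_mu_pos k hy ht

/-- If the equation is oscillatory, its Prüfer angle is unbounded: the angle passes every multiple
of `π` at most once, and each zero of `u` is such a passage. -/
lemma exists_nat_mul_pi_le (h : IsPruferFamily ρ μ ρinf μinf K Φ) {Ω : ℝ}
    (hosc : IsOscillatory μ (gammaCoeff ρ μ K Ω)) (k : ℕ) : ∃ y ≥ 0, k * Real.pi ≤ Φ Ω y := by
  have hzeros := hosc _ _ ((h.angle Ω).isSLSolution h.continuous_inv_mu (h.continuous_gammaCoeff Ω))
    ⟨0, self_mem_Ici, by rw [(h.angle Ω).pruferU_zero]; exact one_ne_zero⟩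
  induction k with
  | zero =>
    refine ⟨0, le_rfl, ?_⟩
    rw [(h.angle Ω).initial]
    simpa using Real.pi_div_two_pos.le
  | succ k ih =>
    obtain ⟨y, hy0, hy⟩ := ih
    obtain ⟨z, ⟨hz0, hz⟩, hyz⟩ := not_bddAbove_iff.1 hzeros y
    refine ⟨z, hz0, ?_⟩
    have hlt := h.nat_mul_pi_lt hy hyz
    have hsin : Real.sin (Φ Ω z) = 0 :=
      (mul_eq_zero.1 hz).resolve_left (pruferModulus_pos _ _ _ _).ne'
    obtain ⟨j, hj⟩ := Real.sin_eq_zero_iff.1 hsin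
    rw [← hj] at hlt ⊢
    have hkj : (k : ℝ) < j := lt_of_mul_lt_mul_right hlt Real.pi_pos.le
    have hkj' : (k : ℤ) + 1 ≤ j := by exact_mod_cast hkj
    refine mul_le_mul_of_nonneg_right ?_ Real.pi_pos.le
    exact_mod_cast hkj'

lemma eventually_nat_mul_pi_lt (h : IsPruferFamily ρ μ ρinf μinf K Φ)
    (hosc : IsOscillatory μ (gammaCoeff ρ μ K (μinf / ρinf * K))) (k : ℕ) {Ω : ℝ}
    (hΩ : μinf / ρinf * K ≤ Ω) : ∀ᶠ t in atTop, k * Real.pi < Φ Ω t := by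
  obtain ⟨y, hy0, hy⟩ := h.exists_nat_mul_pi_le hosc k
  filter_upwards [eventually_gt_atTop y] with t ht
  exact (h.nat_mul_pi_lt hy ht).trans_le (h.angle_mono hΩ (hy0.trans_lt ht))

/-- The parameters below the limiting value form an interval. Those for which the angle exceeds
`m π` somewhere and those for which it ends below `(m - 1/2) π` are disjoint nonempty open subsets,
so they do not exhaust it. -/
theorem exists_endsInSector (h : IsPruferFamily ρ μ ρinf μinf K Φ)
    (hosc : IsOscillatory μ (gammaCoeff ρ μ K (μinf / ρinf * K))) {m : ℕ} (hm : 1 ≤ m) :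
    ∃ Ω < μinf / ρinf * K,
      ∀ᶠ t in atTop, Φ Ω t ∈ Icc (((m : ℝ) - 1 / 2) * Real.pi) (m * Real.pi) := by
  set Ωs := μinf / ρinf * K with hΩs
  set A : Set ℝ := {Ω | ∃ y ≥ 0, m * Real.pi < Φ Ω y} with hA
  set B : Set ℝ := {Ω | Ω < Ωs ∧ ∀ᶠ t in atTop, Φ Ω t < ((m : ℝ) - 1 / 2) * Real.pi} with hB
  have hAo : IsOpen A := by
    have : A = ⋃ y ∈ Ici (0 : ℝ), {Ω | m * Real.pi < Φ Ω y} := by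
      ext Ω
      simp [hA]
    rw [this]
    exact isOpen_biUnion fun y hy => isOpen_lt continuous_const (h.continuous_param hy)
  have hBo : IsOpen B := by
    rw [isOpen_iff_mem_nhds]
    rintro Ω₀ ⟨hlt, hev⟩
    -- One half-line on which the coefficient is negative serves all parameters below `Ω₁`.
    obtain ⟨Ω₁, h01, h1s⟩ := exists_between hlt
    obtain ⟨Y, hY0, hY⟩ := h.exists_forall_gammaCoeff_neg h1s
    obtain ⟨y, hy, hyY⟩ := (hev.and (eventually_ge_atTop Y)).exists
    filter_upwards [gt_mem_nhds h01,
      (isOpen_lt (h.continuous_param (hY0.trans hyY)) continuous_const).mem_nhds hy] with Ω h1 h2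
    exact ⟨h1.trans h1s, (eventually_gt_atTop y).mono fun t ht =>
      (h.angle Ω).lt_nat_sub_half_mul_pi m
        (fun s hs => (h.gammaCoeff_lt h1 s).trans (hY s (hyY.trans hs))) (le_of_lt h2) ht⟩
  have hAne : (Iio Ωs ∩ A).Nonempty := by
    obtain ⟨y, hy, hy0⟩ := ((h.eventually_nat_mul_pi_lt hosc m le_rfl).and
      (eventually_ge_atTop 0)).exists
    have hev : ∀ᶠ Ω in 𝓝[<] Ωs, m * Real.pi < Φ Ω y :=
      nhdsWithin_le_nhds ((isOpen_lt continuous_const (h.continuous_param hy0)).mem_nhds hy)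
    obtain ⟨Ω, h1, h2⟩ := (hev.and self_mem_nhdsWithin).exists
    exact ⟨Ω, h2, y, hy0, h1⟩
  have hBne : (Iio Ωs ∩ B).Nonempty := by
    have h0 : 0 < Ωs := mul_pos (div_pos h.muInf_pos h.rhoInf_pos) h.K_pos
    refine ⟨0, h0, h0, (eventually_gt_atTop 0).mono fun t ht =>
      (h.angle 0).lt_nat_sub_half_mul_pi m (fun s _ => ?_) ?_ ht⟩
    · simpa [gammaCoeff] using mul_pos h.K_pos (h.mu_pos s)
    · rw [(h.angle 0).initial]
      have : (1 : ℝ) ≤ m := by exact_mod_cast hm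
      nlinarith [Real.pi_pos]
  by_contra hcon
  have hcover : Iio Ωs ⊆ A ∪ B := by
    intro Ω hΩ
    by_contra hnot
    rw [mem_union, not_or] at hnot
    have hle : ∀ y ≥ 0, Φ Ω y ≤ m * Real.pi := by simpa [hA] using hnot.1
    have hfreq : ∃ᶠ t in atTop, ((m : ℝ) - 1 / 2) * Real.pi ≤ Φ Ω t := by
      intro hev
      exact hnot.2 ⟨hΩ, hev.mono fun t ht => not_le.1 ht⟩
    obtain ⟨Y, hY0, hY⟩ := h.exists_forall_gammaCoeff_neg hΩ
    refine hcon ⟨Ω, hΩ, eventually_atTop.2 ⟨Y, fun t ht => ⟨?_, hle t (hY0.trans ht)⟩⟩⟩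
    by_contra hlt
    obtain ⟨s, hs, hts⟩ := (hfreq.and_eventually (eventually_gt_atTop t)).exists
    exact hs.not_gt ((h.angle Ω).lt_nat_sub_half_mul_pi m (fun r hr => hY r (ht.trans hr))
      (not_le.1 hlt).le hts)
  obtain ⟨Ω, -, ⟨y, -, hy⟩, -, hev⟩ := isPreconnected_Iio A B hAo hBo hcover hAne hBne
  obtain ⟨t, ht, hyt⟩ := (hev.and (eventually_gt_atTop y)).exists
  have := h.nat_mul_pi_lt hy.le hyt
  linarith [Real.pi_pos]

lemma tendsto_pruferU (h : IsPruferFamily ρ μ ρinf μinf K Φ) {Ω : ℝ} (hΩ : Ω < μinf / ρinf * K)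
    {m : ℕ}
    (hm : ∀ᶠ t in atTop, Φ Ω t ∈ Icc (((m : ℝ) - 1 / 2) * Real.pi) (m * Real.pi)) :
    Tendsto (pruferU (fun t => (μ t)⁻¹) (gammaCoeff ρ μ K Ω) (Φ Ω)) atTop (𝓝 0) := by
  obtain ⟨δ, hδ, hev⟩ := h.exists_eventually_gammaCoeff_le hΩ
  exact (h.angle Ω).tendsto_pruferU h.continuous_inv_mu (h.continuous_gammaCoeff Ω) h.inv_mu_pos
    hδ hev hm

lemma isBVPSolution (h : IsPruferFamily ρ μ ρinf μinf K Φ) {Ω : ℝ} (hΩ : Ω < μinf / ρinf * K)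
    {m : ℕ}
    (hm : ∀ᶠ t in atTop, Φ Ω t ∈ Icc (((m : ℝ) - 1 / 2) * Real.pi) (m * Real.pi)) :
    IsBVPSolution ρ μ K Ω (pruferU (fun t => (μ t)⁻¹) (gammaCoeff ρ μ K Ω) (Φ Ω))
      (pruferW (fun t => (μ t)⁻¹) (gammaCoeff ρ μ K Ω) (Φ Ω)) where
  solution := (h.angle Ω).isSLSolution h.continuous_inv_mu (h.continuous_gammaCoeff Ω)
  nontrivial := ⟨0, self_mem_Ici, by rw [(h.angle Ω).pruferU_zero]; exact one_ne_zero⟩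
  neumann := (((h.angle Ω).isSLSolution h.continuous_inv_mu
    (h.continuous_gammaCoeff Ω)).hasDeriv_u 0 self_mem_Ici).congr_deriv
      (by rw [(h.angle Ω).pruferW_zero, zero_div])
  decay := h.tendsto_pruferU hΩ hm

/-- Where `Ω` does not exceed `K` times the minimum of `μ / ρ` the coefficient is nonpositive, so
the solution does not decay. -/
lemma lt_of_tendsto (h : IsPruferFamily ρ μ ρinf μinf K Φ) {Ω ymin : ℝ}
    (hmin : ∀ t ≥ 0, μ ymin / ρ ymin ≤ μ t / ρ t)
    (hlim : Tendsto (pruferU (fun t => (μ t)⁻¹) (gammaCoeff ρ μ K Ω) (Φ Ω)) atTop (𝓝 0)) :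
    μ ymin / ρ ymin * K < Ω := by
  by_contra hle
  rw [not_lt] at hle
  refine not_tendsto_zero_of_nonpos h.inv_mu_pos
    ((h.angle Ω).hasDerivAt_pruferU h.continuous_inv_mu (h.continuous_gammaCoeff Ω))
    ((h.angle Ω).hasDerivAt_pruferW h.continuous_inv_mu (h.continuous_gammaCoeff Ω))
    (fun t ht => ?_) (h.angle Ω).pruferW_zero (by rw [(h.angle Ω).pruferU_zero]; exact one_ne_zero)
    hlim
  have h1 : Ω ≤ μ t / ρ t * K := hle.trans (mul_le_mul_of_nonneg_right (hmin t ht) h.K_pos.le)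
  rw [div_mul_eq_mul_div, le_div_iff₀ (h.rho_pos t)] at h1
  unfold gammaCoeff
  linarith

lemma eq_of_same_sector (h : IsPruferFamily ρ μ ρinf μinf K Φ) {m : ℕ} {Ω₁ Ω₂ : ℝ}
    (hΩ₁ : Ω₁ < μinf / ρinf * K) (hΩ₂ : Ω₂ < μinf / ρinf * K)
    (h₁ : ∀ᶠ t in atTop, Φ Ω₁ t ∈ Icc (((m : ℝ) - 1 / 2) * Real.pi) (m * Real.pi))
    (h₂ : ∀ᶠ t in atTop, Φ Ω₂ t ∈ Icc (((m : ℝ) - 1 / 2) * Real.pi) (m * Real.pi)) :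
    Ω₁ = Ω₂ := by
  wlog hlt : Ω₁ < Ω₂ generalizing Ω₁ Ω₂
  · rcases (not_lt.1 hlt).eq_or_lt with heq | hgt
    · exact heq.symm
    · exact (this hΩ₂ hΩ₁ h₂ h₁ hgt).symm
  · obtain ⟨Y, -, hY⟩ := h.exists_forall_gammaCoeff_neg hΩ₂
    exact ((h.angle Ω₁).not_same_sector h.continuous_inv_mu (h.continuous_gammaCoeff Ω₁)
      (h.continuous_gammaCoeff Ω₂) (h.angle Ω₂) (fun t _ => (h.gammaCoeff_lt hlt t).le)
      (h.gammaCoeff_lt hlt 0) (eventually_atTop.2 ⟨Y, fun t ht => (hY t ht).le⟩)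
      (h.tendsto_pruferU hΩ₁ h₁) (h.tendsto_pruferU hΩ₂ h₂) h₁ h₂).elim

/-- Any solution of the boundary value problem ending in a sector is a positive multiple of the
one constructed from the Prüfer angle of its parameter. -/
lemma eq_const_mul_of_endsInSector (h : IsPruferFamily ρ μ ρinf μinf K Φ) {m : ℕ} {Ω : ℝ}
    {u w : ℝ → ℝ} (hs : IsBVPSolution ρ μ K Ω u w) (hm : EndsInSector m u w) :
    (∀ᶠ t in atTop, Φ Ω t ∈ Icc (((m : ℝ) - 1 / 2) * Real.pi) (m * Real.pi)) ∧
      ∃ c : ℝ, 0 < c ∧ ∀ y ∈ Ici (0 : ℝ),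
        u y = c * pruferU (fun t => (μ t)⁻¹) (gammaCoeff ρ μ K Ω) (Φ Ω) y ∧
        w y = c * pruferW (fun t => (μ t)⁻¹) (gammaCoeff ρ μ K Ω) (Φ Ω) y := by
  obtain ⟨ψ, hψ, hev⟩ := hm
  have hw0 : w 0 = 0 := by
    have := (uniqueDiffWithinAt_Ici (0 : ℝ)).eq_deriv _
      (hs.solution.hasDeriv_u 0 self_mem_Ici) hs.neumann
    exact (div_eq_zero_iff.1 this).resolve_right (h.mu_pos 0).ne'
  obtain ⟨c, hc, heq, hang⟩ := (h.angle Ω).eq_const_mul h.continuous_inv_mu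
    (h.continuous_gammaCoeff Ω) hs.solution hs.nontrivial hw0 hψ
  refine ⟨?_, c, hc, heq⟩
  filter_upwards [hev, eventually_ge_atTop 0] with t ht ht0
  rwa [hang ht0]

theorem exists_eigenvalue_sequence (h : IsPruferFamily ρ μ ρinf μinf K Φ) {ymin : ℝ}
    (hmin : ∀ t ≥ 0, μ ymin / ρ ymin ≤ μ t / ρ t)
    (hosc : IsOscillatory μ (gammaCoeff ρ μ K (μinf / ρinf * K))) :
    ∃ Ω : ℕ → ℝ,
      (∀ m : ℕ, 1 ≤ m → Ω m ∈ Ioo (μ ymin / ρ ymin * K) (μinf / ρinf * K)) ∧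
      StrictMonoOn Ω (Ici 1) ∧
      Tendsto Ω atTop (𝓝 (μinf / ρinf * K)) ∧
      ∀ m : ℕ, 1 ≤ m →
        ∃ u w : ℝ → ℝ, IsBVPSolution ρ μ K (Ω m) u w ∧ EndsInSector m u w ∧
          ∀ (Ω' : ℝ) (u' w' : ℝ → ℝ), IsBVPSolution ρ μ K Ω' u' w' →
            EndsInSector m u' w' →
            Ω' = Ω m ∧
              ∃ c : ℝ, 0 < c ∧ ∀ y ∈ Ici (0 : ℝ), u' y = c * u y ∧ w' y = c * w y := by
  have hex : ∀ m : ℕ, ∃ Ω : ℝ, 1 ≤ m → Ω < μinf / ρinf * K ∧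
      ∀ᶠ t in atTop, Φ Ω t ∈ Icc (((m : ℝ) - 1 / 2) * Real.pi) (m * Real.pi) := by
    intro m
    by_cases hm : 1 ≤ m
    · obtain ⟨Ω, h1, h2⟩ := h.exists_endsInSector hosc hm
      exact ⟨Ω, fun _ => ⟨h1, h2⟩⟩
    · exact ⟨0, fun h' => absurd h' hm⟩
  choose Ω hΩ using hex
  refine ⟨Ω, fun m hm => ⟨h.lt_of_tendsto hmin (h.tendsto_pruferU (hΩ m hm).1 (hΩ m hm).2),
    (hΩ m hm).1⟩, ?_, ?_, ?_⟩
  · intro m hm n hn hmn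
    by_contra hle
    rw [not_lt] at hle
    obtain ⟨t, ⟨ht1, ht2⟩, ht0⟩ :=
      (((hΩ m hm).2.and (hΩ n hn).2).and (eventually_gt_atTop 0)).exists
    have h1 := h.angle_mono hle ht0
    have h2 : (m : ℝ) + 1 ≤ n := by exact_mod_cast hmn
    have h3 := ht1.2
    have h4 := ht2.1
    nlinarith [Real.pi_pos]
  · refine tendsto_order.2 ⟨fun a ha => ?_, fun a ha => ?_⟩
    · -- The angle for the parameter `a` is bounded, so it cannot dominate large sectors.
      obtain ⟨k, hk⟩ := h.exists_eventually_angle_lt ha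
      filter_upwards [eventually_ge_atTop (max 1 k)] with m hm
      by_contra hle
      rw [not_lt] at hle
      obtain ⟨t, ⟨ht1, ht2⟩, ht0⟩ := ((hk.and (hΩ m ((le_max_left _ _).trans hm)).2).and
        (eventually_gt_atTop 0)).exists
      have h1 := h.angle_mono hle ht0
      have h2 : (k : ℝ) ≤ m := by exact_mod_cast (le_max_right _ _).trans hm
      have h4 := ht2.1
      nlinarith [Real.pi_pos]
    · filter_upwards [eventually_ge_atTop 1] with m hm
      exact (hΩ m hm).1.trans ha
  · intro m hm
    refine ⟨_, _, h.isBVPSolution (hΩ m hm).1 (hΩ m hm).2,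
      ⟨Φ (Ω m), (h.angle (Ω m)).isPruferAngle, (hΩ m hm).2⟩, fun Ω' u' w' hs hsec => ?_⟩
    obtain ⟨hev, c, hc, heq⟩ := h.eq_const_mul_of_endsInSector hs hsec
    have hlt : Ω' < μinf / ρinf * K := by
      by_contra hge
      obtain ⟨t, ht1, ht2⟩ :=
        ((h.eventually_nat_mul_pi_lt hosc m (not_lt.1 hge)).and hev).exists
      exact ht2.2.not_gt ht1
    obtain rfl := h.eq_of_same_sector hlt (hΩ m hm).1 hev (hΩ m hm).2
    exact ⟨rfl, c, hc, heq⟩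

end IsPruferFamily

/-! ### Extension of the medium to the whole line -/

lemma IsSLSolution.congr_coeff {μ₁ γ₁ μ₂ γ₂ u w : ℝ → ℝ} (h : IsSLSolution μ₁ γ₁ u w)
    (hμ : EqOn μ₁ μ₂ (Ici 0)) (hγ : EqOn γ₁ γ₂ (Ici 0)) : IsSLSolution μ₂ γ₂ u w where
  hasDeriv_u y hy := hμ hy ▸ h.hasDeriv_u y hy
  hasDeriv_w y hy := hγ hy ▸ h.hasDeriv_w y hy

lemma eqOn_comp_max_zero (f : ℝ → ℝ) : EqOn (fun t => f (max t 0)) f (Ici 0) :=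
  fun t (ht : 0 ≤ t) => congrArg f (max_eq_left ht)

lemma isBVPSolution_comp_max_iff {ρ μ : ℝ → ℝ} {K Ω : ℝ} {u w : ℝ → ℝ} :
    IsBVPSolution (fun t => ρ (max t 0)) (fun t => μ (max t 0)) K Ω u w ↔
      IsBVPSolution ρ μ K Ω u w := by
  have hγ : EqOn (gammaCoeff (fun t => ρ (max t 0)) (fun t => μ (max t 0)) K Ω)
      (gammaCoeff ρ μ K Ω) (Ici 0) := fun t ht => by
    simp only [gammaCoeff, max_eq_left (show (0 : ℝ) ≤ t from ht)]
  have hμ := eqOn_comp_max_zero μ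
  exact ⟨fun h => ⟨h.solution.congr_coeff hμ hγ, h.nontrivial, h.neumann, h.decay⟩,
    fun h => ⟨h.solution.congr_coeff hμ.symm hγ.symm, h.nontrivial, h.neumann, h.decay⟩⟩

lemma continuous_comp_max_zero {f : ℝ → ℝ} {L : NNReal} (hf : LipschitzOnWith L f (Ici 0)) :
    Continuous fun t => f (max t 0) :=
  hf.continuousOn.comp_continuous (by fun_prop) fun _ => mem_Ici.2 (le_max_right _ _)

/-- Positive monotonicity puts a value of `μ / ρ` below its limit at infinity, hence the minimum
over a suitable bounded interval is a minimum over `[0, ∞)`. -/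
lemma exists_isMinOn_ratio {ρ μ : ℝ → ℝ} {ρinf μinf : ℝ} (hmed : IsMedium ρ μ ρinf μinf)
    (hmon : PositiveMonotoneAtInfinity ρ μ ρinf μinf) :
    ∃ ymin ∈ Ici (0 : ℝ), IsMinOn (fun y => μ y / ρ y) (Ici 0) ymin := by
  obtain ⟨ybar, hybar, hlt⟩ := hmon
  obtain ⟨L₁, hL₁⟩ := hmed.rho_lipschitz
  obtain ⟨L₂, hL₂⟩ := hmed.mu_lipschitz
  have hcont : ContinuousOn (fun y => μ y / ρ y) (Ici 0) :=
    hL₂.continuousOn.div hL₁.continuousOn fun y hy => (hmed.rho_pos y hy).ne'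
  have hlim : Tendsto (fun y => μ y / ρ y) atTop (𝓝 (μinf / ρinf)) :=
    hmed.mu_tendsto.div hmed.rho_tendsto hmed.rhoInf_pos.ne'
  have h1 : μ (ybar + 1) / ρ (ybar + 1) < μinf / ρinf :=
    Real.arctan_strictMono.lt_iff_lt.1 (hlt (ybar + 1) (lt_add_one ybar))
  obtain ⟨Y, hY⟩ := eventually_atTop.1 (hlim.eventually (lt_mem_nhds h1))
  have hmem : ybar + 1 ∈ Icc 0 (max Y (ybar + 1)) :=
    ⟨add_nonneg hybar zero_le_one, le_max_right _ _⟩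
  obtain ⟨ymin, hy, hymin⟩ := isCompact_Icc.exists_isMinOn ⟨_, hmem⟩
    (hcont.mono (Icc_subset_Ici_self : Icc 0 (max Y (ybar + 1)) ⊆ Ici 0))
  refine ⟨ymin, hy.1, fun y hy0 => ?_⟩
  rcases le_total y (max Y (ybar + 1)) with hle | hge
  · exact hymin ⟨hy0, hle⟩
  · exact (hymin hmem).trans (hY y ((le_max_left _ _).trans hge)).le

theorem theorem3 (ρ μ : ℝ → ℝ) (ρinf μinf : ℝ) (hmed : IsMedium ρ μ ρinf μinf)
    (hmon : PositiveMonotoneAtInfinity ρ μ ρinf μinf) :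
    ∃ ymin ∈ Ici (0 : ℝ), IsMinOn (fun y => μ y / ρ y) (Ici 0) ymin ∧
      ∀ K : ℝ, 0 < K →
        IsOscillatory μ (fun y => K / ρinf * gammaHatInf ρ μ ρinf μinf y) →
        ∃ Ω : ℕ → ℝ,
          (∀ m : ℕ, 1 ≤ m → Ω m ∈ Ioo (μ ymin / ρ ymin * K) (μinf / ρinf * K)) ∧
          StrictMonoOn Ω (Ici 1) ∧
          Tendsto Ω atTop (𝓝 (μinf / ρinf * K)) ∧
          ∀ m : ℕ, 1 ≤ m →
            ∃ u w : ℝ → ℝ, IsBVPSolution ρ μ K (Ω m) u w ∧ EndsInSector m u w ∧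
              ∀ (Ω' : ℝ) (u' w' : ℝ → ℝ), IsBVPSolution ρ μ K Ω' u' w' →
                EndsInSector m u' w' →
                Ω' = Ω m ∧
                  ∃ c : ℝ, 0 < c ∧ ∀ y ∈ Ici (0 : ℝ), u' y = c * u y ∧ w' y = c * w y := by
  obtain ⟨ymin, hy0, hymin⟩ := exists_isMinOn_ratio hmed hmon
  refine ⟨ymin, hy0, hymin, fun K hK hosc => ?_⟩
  obtain ⟨L₁, hL₁⟩ := hmed.rho_lipschitz
  obtain ⟨L₂, hL₂⟩ := hmed.mu_lipschitz
  have hρc := continuous_comp_max_zero hL₁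
  have hμc := continuous_comp_max_zero hL₂
  have hμ0 : ∀ t : ℝ, 0 < μ (max t 0) := fun t => hmed.mu_pos _ (mem_Ici.2 (le_max_right _ _))
  have hmax : ∀ f : ℝ → ℝ, (fun t => f (max t 0)) =ᶠ[atTop] f := fun f =>
    (eventually_ge_atTop 0).mono (eqOn_comp_max_zero f)
  have hex : ∀ Ω : ℝ, ∃ φ, IsPruferSolution (fun t => (μ (max t 0))⁻¹)
      (gammaCoeff (fun t => ρ (max t 0)) (fun t => μ (max t 0)) K Ω) φ := fun Ω =>
    exists_pruferSolution (hμc.inv₀ fun t => (hμ0 t).ne')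
      ((hρc.const_mul Ω).sub (hμc.const_mul K))
  choose Φ hΦ using hex
  have hfam : IsPruferFamily (fun t => ρ (max t 0)) (fun t => μ (max t 0)) ρinf μinf K Φ :=
    { continuous_rho := hρc
      continuous_mu := hμc
      rho_pos := fun t => hmed.rho_pos _ (mem_Ici.2 (le_max_right _ _))
      mu_pos := hμ0
      rhoInf_pos := hmed.rhoInf_pos
      muInf_pos := hmed.muInf_pos
      rho_tendsto := hmed.rho_tendsto.congr' (hmax ρ).symm
      mu_tendsto := hmed.mu_tendsto.congr' (hmax μ).symm
      K_pos := hK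
      angle := hΦ }
  have hymax : max ymin 0 = ymin := max_eq_left hy0
  have hmin : ∀ t : ℝ, t ≥ 0 →
      μ (max ymin 0) / ρ (max ymin 0) ≤ μ (max t 0) / ρ (max t 0) := fun t _ => by
    rw [hymax]
    exact hymin (le_max_right t 0)
  have hosc' : IsOscillatory (fun t => μ (max t 0))
      (gammaCoeff (fun t => ρ (max t 0)) (fun t => μ (max t 0)) K (μinf / ρinf * K)) := by
    intro u w hs
    refine hosc u w (hs.congr_coeff (eqOn_comp_max_zero μ) fun t (ht : 0 ≤ t) => ?_)
    have := hmed.rhoInf_pos.ne'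
    simp only [gammaCoeff, gammaHatInf, max_eq_left ht]
    field_simp
    ring
  have key := hfam.exists_eigenvalue_sequence (ymin := ymin) hmin hosc'
  simp only [isBVPSolution_comp_max_iff, hymax] at key
  exact key
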